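/- Let $p$ be a prime and let $\mathcal O$ be a complete discrete valuation ring whose residue field is algebraically closed of characteristic $p$ and whose field of fractions $K$ has characteristic $0$. Let $t>1$ be an integer coprime to $p$, let $n$ be the multiplicative order of $p$ modulo $t^2$, and set $s=(p^{nt}-1)/(t(p^n-1))$ (an integer coprime to $pt$). Let $D$ be the additive group of $\mathbb F_{p^{nt}}$, let $\omega_s,\omega_{t^2}\in\mathbb F_{p^{nt}}^\times$ be roots of unity of exact orders $s$ and $t^2$, write $m_\lambda\in\mathrm{Aut}(D)$ for multiplication by $\lambda$, and $\Phi_{p^n}\in\mathrm{Aut}(D)$ for $x\mapsto x^{p^n}$. Put $g=m_{\omega_s}$ and $h=\Phi_{p^n}\circ m_{\omega_{t^2}}$; then $hgh^{-1}=g^{p^n}$, and we set $E=\langle g\rangle\rtimes\langle h\rangle\cong C_s\rtimes C_{t^2}$ and $G=D\rtimes E$ with the natural action of $E$ on $D$. Assume that $K$ contains all $|G|$-th roots of unity. Let $\mathrm{Aut}_c(G)$ be the group of automorphisms of $G$ that leave every conjugacy class of $G$ invariant and $\mathrm{Out}_c(G)=\mathrm{Aut}_c(G)/\mathrm{Inn}(G)$.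 Let $\mathrm{Pic}(\mathcal OG)$ be the group of isomorphism classes of $\mathcal OG$-$\mathcal OG$-bimodules (with $\mathcal O$ acting in the same way from both sides) inducing $\mathcal O$-linear Morita auto-equivalences of $\mathcal OG$, with product $\otimes_{\mathcal OG}$, and let $\mathrm{Picent}(\mathcal OG)$ be the subgroup of those classes that induce the trivial permutation of the irreducible characters $\mathrm{Irr}(G)$ (over $K$). For $\alpha\in\mathrm{Aut}(G)$, extended linearly to $\mathcal OG$, let ${}_\alpha(\mathcal OG)$ be $\mathcal OG$ with the bimodule structure $x\cdot m\cdot y=\alpha(x)my$. Then $\mathrm{Out}_c(G)$ is non-trivial. Moreover, $\alpha\mapsto{}_\alpha(\mathcal OG)$ induces a well-defined homomorphism from the opposite group of $\mathrm{Out}_c(G)$ to $\mathrm{Picent}(\mathcal OG)$, and its image is non-trivial. More precisely, the map $\psi_G$ of $G=D\rtimes E$ that acts on $D$ as $m_{\omega_{t^2}}$ and trivially on $E$ is a class-preserving automorphism of $G$ that is not inner, and ${}_{\psi_G}(\mathcal OG)$ is a non-trivial element of $\mathrm{Picent}(\mathcal OG)$. -/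

import Mathlib

open scoped TensorProduct

universe u v w

/-! ### Tensor products over a noncommutative ring -/

section Balanced

variable (A : Type u) [Ring A]

/-- For a right `A`-module `M` and a left `A`-module `V`, the relations
`(m a) ⊗ v = m ⊗ (a v)` inside `M ⊗_ℤ V`.  As `M` is moreover a left `A`-module whose action commutes
with the right one, these relations are stable under `A`, so that their `A`-span is their
additive span. -/
def balRel (M : Type v) (V : Type w) [AddCommGroup M] [Module A M] [Module Aᵐᵒᵖ M]
    [AddCommGroup V] [Module A V] : Submodule A (M ⊗[ℤ] V) :=
  Submodule.span A
    {x | ∃ (m : M) (a : A) (v : V), x = (MulOpposite.op a • m) ⊗ₜ[ℤ] v - m ⊗ₜ[ℤ] (a • v)}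

/-- The tensor product `M ⊗_A V` of an `A`-`A`-bimodule `M` and a left `A`-module `V`, as a left
`A`-module. -/
abbrev BalTensor (M : Type v) (V : Type w) [AddCommGroup M] [Module A M] [Module Aᵐᵒᵖ M]
    [AddCommGroup V] [Module A V] : Type (max v w) :=
  (M ⊗[ℤ] V) ⧸ balRel A M V

/-- The pure tensor `m ⊗ v` in `M ⊗_A V`. -/
def balTmul {M : Type v} {V : Type w} [AddCommGroup M] [Module A M] [Module Aᵐᵒᵖ M]
    [AddCommGroup V] [Module A V] (m : M) (v : V) : BalTensor A M V :=
  (balRel A M V).mkQ (m ⊗ₜ[ℤ] v)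

variable {A} {M : Type v} {V : Type w} [AddCommGroup M] [Module A M] [Module Aᵐᵒᵖ M]
  [AddCommGroup V] [Module A V]

theorem balTmul_add_left (m m' : M) (v : V) :
    balTmul A (m + m') v = balTmul A m v + balTmul A m' v := by
  simp [balTmul, TensorProduct.add_tmul]

theorem balTmul_add_right (m : M) (v v' : V) :
    balTmul A m (v + v') = balTmul A m v + balTmul A m v' := by
  simp [balTmul, TensorProduct.tmul_add]

theorem smul_balTmul (a : A) (m : M) (v : V) :
    a • balTmul A m v = balTmul A (a • m) v := by
  rw [balTmul, balTmul, ← map_smul, TensorProduct.smul_tmul']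

theorem balTmul_balanced (a : A) (m : M) (v : V) :
    balTmul A (MulOpposite.op a • m) v = balTmul A m (a • v) := by
  rw [balTmul, balTmul, ← sub_eq_zero, ← map_sub, Submodule.mkQ_apply,
    Submodule.Quotient.mk_eq_zero]
  exact Submodule.subset_span ⟨m, a, v, rfl⟩

theorem bal_induction {P : BalTensor A M V → Prop} (x : BalTensor A M V)
    (htmul : ∀ m v, P (balTmul A m v)) (hadd : ∀ x y, P x → P y → P (x + y)) : P x := by
  obtain ⟨y, rfl⟩ := (balRel A M V).mkQ_surjective x
  induction y with
  | zero =>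
    have h := htmul (0 : M) (0 : V)
    rwa [balTmul, TensorProduct.zero_tmul] at h
  | tmul m v => exact htmul m v
  | add y z hy hz =>
    rw [map_add]
    exact hadd _ _ hy hz

/-- The universal property of `M ⊗_A V`: balanced biadditive maps factor through it. -/
def balLift [SMulCommClass A Aᵐᵒᵖ M] {P : Type*} [AddCommGroup P] (f : M → V → P)
    (hl : ∀ m m' v, f (m + m') v = f m v + f m' v)
    (hr : ∀ m v v', f m (v + v') = f m v + f m v')
    (hb : ∀ (a : A) m v, f (MulOpposite.op a • m) v = f m (a • v)) : BalTensor A M V →+ P :=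
  let F : M ⊗[ℤ] V →+ P :=
    TensorProduct.liftAddHom
      (AddMonoidHom.mk' (fun m => AddMonoidHom.mk' (f m) (hr m))
        (fun m m' => by ext v; exact hl m m' v))
      (fun r m v => by
        have h₁ := map_zsmul (AddMonoidHom.mk' (fun m => f m v) (fun m m' => hl m m' v)) r m
        have h₂ := map_zsmul (AddMonoidHom.mk' (f m) (hr m)) r v
        exact h₁.trans h₂.symm)
  QuotientAddGroup.lift (balRel A M V).toAddSubgroup F (by
    have key : ∀ x ∈ balRel A M V, ∀ a : A, F (a • x) = 0 := by
      intro x hx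
      induction hx using Submodule.span_induction with
      | mem x hx =>
        obtain ⟨m, b, v, rfl⟩ := hx
        intro a
        rw [smul_sub, map_sub, TensorProduct.smul_tmul', TensorProduct.smul_tmul',
          smul_comm a (MulOpposite.op b) m, sub_eq_zero]
        exact hb b (a • m) v
      | zero => intro a; simp
      | add x y _ _ hx hy => intro a; rw [smul_add, map_add, hx, hy, add_zero]
      | smul b x _ hx => intro a; rw [← mul_smul]; exact hx _
    intro x hx
    have := key x hx 1
    rwa [one_smul] at this)

@[simp] theorem balLift_tmul [SMulCommClass A Aᵐᵒᵖ M] {P : Type*} [AddCommGroup P] (f : M → V → P)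
    (hl : ∀ m m' v, f (m + m') v = f m v + f m' v)
    (hr : ∀ m v v', f m (v + v') = f m v + f m v')
    (hb : ∀ (a : A) m v, f (MulOpposite.op a • m) v = f m (a • v)) (m : M) (v : V) :
    balLift f hl hr hb (balTmul A m v) = f m v := rfl

/-- Two additive maps on `M ⊗_A V` that agree on pure tensors are equal. -/
theorem bal_hom_ext {P : Type*} [AddCommGroup P] {f g : BalTensor A M V →+ P}
    (h : ∀ m v, f (balTmul A m v) = g (balTmul A m v)) : f = g := by
  ext x
  induction x using bal_induction with
  | htmul m v => exact h m v
  | hadd x y hx hy => rw [map_add, map_add, hx, hy]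

/-- An additive map from `M ⊗_A V` that is `A`-linear on pure tensors is `A`-linear. -/
def balLinear {P : Type*} [AddCommGroup P] [Module A P] (f : BalTensor A M V →+ P)
    (h : ∀ (a : A) m v, f (balTmul A (a • m) v) = a • f (balTmul A m v)) :
    BalTensor A M V →ₗ[A] P where
  toFun := f
  map_add' := map_add f
  map_smul' a x := by
    induction x using bal_induction with
    | htmul m v => rw [smul_balTmul, h]; rfl
    | hadd x y hx hy => rw [smul_add, map_add, map_add, smul_add, hx, hy]

/-- Functoriality of `M ⊗_A V`. -/
def balMap {M' V' : Type*} [AddCommGroup M'] [Module A M'] [Module Aᵐᵒᵖ M'] [AddCommGroup V']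
    [Module A V'] [SMulCommClass A Aᵐᵒᵖ M]
    (e : M →ₗ[A] M') (he : ∀ (a : A) m, e (MulOpposite.op a • m) = MulOpposite.op a • e m)
    (f : V →ₗ[A] V') : BalTensor A M V →ₗ[A] BalTensor A M' V' :=
  balLinear
    (balLift (fun m v => balTmul A (e m) (f v))
      (fun m m' v => by rw [map_add, balTmul_add_left])
      (fun m v v' => by rw [map_add, balTmul_add_right])
      (fun a m v => by rw [he, balTmul_balanced, map_smul]))
    (fun a m v => by simp only [balLift_tmul, map_smul, smul_balTmul])

@[simp] theorem balMap_tmul {M' V' : Type*} [AddCommGroup M'] [Module A M'] [Module Aᵐᵒᵖ M']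
    [AddCommGroup V'] [Module A V'] [SMulCommClass A Aᵐᵒᵖ M]
    (e : M →ₗ[A] M') (he : ∀ (a : A) m, e (MulOpposite.op a • m) = MulOpposite.op a • e m)
    (f : V →ₗ[A] V') (m : M) (v : V) :
    balMap e he f (balTmul A m v) = balTmul A (e m) (f v) := rfl

/-- Two linear maps on `M ⊗_A V` that agree on pure tensors are equal. -/
theorem bal_linear_ext {P : Type*} [AddCommGroup P] [Module A P] {f g : BalTensor A M V →ₗ[A] P}
    (h : ∀ m v, f (balTmul A m v) = g (balTmul A m v)) : f = g :=
  LinearMap.toAddMonoidHom_injective (bal_hom_ext h)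

/-- Functoriality of `M ⊗_A V` for isomorphisms. -/
def balCongr {M' V' : Type*} [AddCommGroup M'] [Module A M'] [Module Aᵐᵒᵖ M'] [AddCommGroup V']
    [Module A V'] [SMulCommClass A Aᵐᵒᵖ M] [SMulCommClass A Aᵐᵒᵖ M']
    (e : M ≃ₗ[A] M') (he : ∀ (a : A) m, e (MulOpposite.op a • m) = MulOpposite.op a • e m)
    (f : V ≃ₗ[A] V') : BalTensor A M V ≃ₗ[A] BalTensor A M' V' :=
  LinearEquiv.ofLinearMap (balMap e.toLinearMap he f.toLinearMap)
    (balMap e.symm.toLinearMap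
      (fun a m => by
        apply e.injective
        simp [he]) f.symm.toLinearMap)
    (bal_linear_ext (fun m v => by simp))
    (bal_linear_ext (fun m v => by simp))

/-- `A ⊗_A V ≅ V`. -/
def balUnitLeft : BalTensor A A V ≃ₗ[A] V :=
  LinearEquiv.ofLinearMap
    (balLinear (balLift (fun (a : A) (v : V) => a • v)
      (fun a b v => add_smul a b v) (fun a v v' => smul_add a v v')
      (fun a b v => by rw [op_smul_eq_mul, mul_smul]))
      (fun a b v => by simp only [balLift_tmul, smul_eq_mul, mul_smul]))
    { toFun := fun v => balTmul A (1 : A) v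
      map_add' := balTmul_add_right 1
      map_smul' := fun a v => by
        rw [RingHom.id_apply, smul_balTmul, ← balTmul_balanced, op_smul_eq_mul, one_mul,
          smul_eq_mul, mul_one] }
    (by ext v; exact one_smul A v)
    (bal_linear_ext (fun a v => by
      change balTmul A (1 : A) (a • v) = balTmul A a v
      rw [← balTmul_balanced, op_smul_eq_mul, one_mul]))

end Balanced

section BalancedBimodule

variable {A : Type u} [Ring A] {M : Type v} {N : Type w}
  [AddCommGroup M] [Module A M] [Module Aᵐᵒᵖ M] [SMulCommClass A Aᵐᵒᵖ M]
  [AddCommGroup N] [Module A N] [Module Aᵐᵒᵖ N] [SMulCommClass A Aᵐᵒᵖ N]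

/-- The endomorphism `m ⊗ n ↦ m ⊗ (n a)` of the left module `M ⊗_A N`. -/
def balRight (a : Aᵐᵒᵖ) : BalTensor A M N →ₗ[A] BalTensor A M N :=
  balMap LinearMap.id (fun _ _ => rfl)
    { toFun := fun n => a • n
      map_add' := smul_add a
      map_smul' := fun b n => (smul_comm b a n).symm }

/-- The right `A`-module structure `(m ⊗ n) a = m ⊗ (n a)` on the tensor product `M ⊗_A N` of
bimodules. -/
abbrev balRightModule : Module Aᵐᵒᵖ (BalTensor A M N) where
  smul a x := balRight a x
  one_smul x := by
    change balRight 1 x = x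
    induction x using bal_induction with
    | htmul m n => simp [balRight]
    | hadd x y hx hy => rw [map_add, hx, hy]
  mul_smul a b x := by
    change balRight (a * b) x = balRight a (balRight b x)
    induction x using bal_induction with
    | htmul m n => simp [balRight, mul_smul]
    | hadd x y hx hy => rw [map_add, map_add, map_add, hx, hy]
  smul_zero a := map_zero _
  smul_add a := map_add _
  add_smul a b x := by
    change balRight (a + b) x = balRight a x + balRight b x
    induction x using bal_induction with
    | htmul m n => simp [balRight, add_smul, balTmul_add_right]
    | hadd x y hx hy => rw [map_add, map_add, map_add, hx, hy]; abel
  zero_smul x := by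
    change balRight 0 x = 0
    induction x using bal_induction with
    | htmul m n =>
      have h := balTmul_add_right (A := A) m (0 : N) 0
      rw [add_zero] at h
      simpa [balRight] using h
    | hadd x y hx hy => rw [map_add, hx, hy, add_zero]

end BalancedBimodule

/-! ### The Picard group of an algebra -/

/-- An `A`-`A`-bimodule for an `R`-algebra `A`, with `R` acting in the same way from both sides.
The right action of `A` is written as a left action of `Aᵐᵒᵖ`. -/
structure ABimodule (R : Type u) (A : Type v) [CommRing R] [Ring A] [Algebra R A] where
  carrier : Type v
  [addCommGroup : AddCommGroup carrier]
  [left : Module A carrier]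
  [right : Module Aᵐᵒᵖ carrier]
  [comm : SMulCommClass A Aᵐᵒᵖ carrier]
  central : ∀ (r : R) (m : carrier),
    MulOpposite.op (algebraMap R A r) • m = algebraMap R A r • m

namespace ABimodule

attribute [instance] addCommGroup left right comm

variable {R : Type u} {A : Type v} [CommRing R] [Ring A] [Algebra R A]

/-- Isomorphism of bimodules. -/
def Iso (M N : ABimodule R A) : Prop :=
  ∃ e : M.carrier ≃ₗ[A] N.carrier,
    ∀ (a : A) (m : M.carrier), e (MulOpposite.op a • m) = MulOpposite.op a • e m

theorem Iso.refl (M : ABimodule R A) : Iso M M := ⟨LinearEquiv.refl A _, fun _ _ => rfl⟩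

theorem Iso.symm {M N : ABimodule R A} : Iso M N → Iso N M := fun ⟨e, he⟩ =>
  ⟨e.symm, fun a n => by apply e.injective; simp [he]⟩

theorem Iso.trans {M N P : ABimodule R A} : Iso M N → Iso N P → Iso M P :=
  fun ⟨e, he⟩ ⟨f, hf⟩ => ⟨e.trans f, fun a n => by simp [he, hf]⟩

instance setoid : Setoid (ABimodule R A) := ⟨Iso, ⟨Iso.refl, Iso.symm, Iso.trans⟩⟩

/-- The regular bimodule twisted on the left by an algebra automorphism: `A` as a set, with
`x · m · y = α(x) m y`. -/
def twist (α : A ≃ₐ[R] A) : ABimodule R A where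
  carrier := A
  left := Module.compHom A (α : A →+* A)
  comm := @SMulCommClass.mk A Aᵐᵒᵖ A (Module.compHom A (α : A →+* A)).toSMul _
    (fun a b m => (mul_assoc (α a) m b.unop).symm)
  central r m := by
    change m * algebraMap R A r = α (algebraMap R A r) * m
    rw [AlgEquiv.commutes, Algebra.commutes]

/-- The regular bimodule. -/
def unit (R : Type u) (A : Type v) [CommRing R] [Ring A] [Algebra R A] : ABimodule R A where
  carrier := A
  central r m := (Algebra.commutes r m).symm

/-- The tensor product `M ⊗_A N` of bimodules. -/
def tensor (M N : ABimodule R A) : ABimodule R A where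
  carrier := BalTensor A M.carrier N.carrier
  right := balRightModule
  comm :=
    letI : Module Aᵐᵒᵖ (BalTensor A M.carrier N.carrier) := balRightModule
    ⟨fun a b x => ((balRight b).map_smul a x).symm⟩
  central r x := by
    change balRight (MulOpposite.op (algebraMap R A r)) x = algebraMap R A r • x
    induction x using bal_induction with
    | htmul m n =>
      simp [balRight, N.central, smul_balTmul, ← M.central, balTmul_balanced]
    | hadd x y hx hy => rw [map_add, smul_add, hx, hy]

/-- The map `n ↦ n ⊗ v` is linear on the left. -/
def inLeft (N : ABimodule R A) {V : Type w} [AddCommGroup V] [Module A V] (v : V) :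
    N.carrier →ₗ[A] BalTensor A N.carrier V where
  toFun n := balTmul A n v
  map_add' n n' := balTmul_add_left n n' v
  map_smul' a n := (smul_balTmul a n v).symm

theorem smul_tensor (M N : ABimodule R A) (a : A) (m : M.carrier) (n : N.carrier) :
    MulOpposite.op a • (show (M.tensor N).carrier from balTmul A m n) =
      (show (M.tensor N).carrier from balTmul A m (MulOpposite.op a • n)) := rfl

/-- Associativity, forward direction. -/
def assocHom (M N : ABimodule R A) (V : Type w) [AddCommGroup V] [Module A V] :
    BalTensor A (M.tensor N).carrier V →+ BalTensor A M.carrier (BalTensor A N.carrier V) :=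
  balLift
    (fun x v => balMap (LinearMap.id : M.carrier →ₗ[A] M.carrier) (fun _ _ => rfl)
      (N.inLeft v) x)
    (fun x y v => map_add _ _ _)
    (fun x v v' => by
      induction x using bal_induction with
      | htmul m n => simp [inLeft, balTmul_add_right]
      | hadd x y hx hy =>
        refine (map_add _ _ _).trans ?_
        refine Eq.trans ?_ (congrArg₂ (· + ·) (map_add _ _ _) (map_add _ _ _)).symm
        refine (congrArg₂ (· + ·) hx hy).trans ?_
        exact add_add_add_comm _ _ _ _)
    (fun a x v => by
      induction x using bal_induction with
      | htmul m n =>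
        change balTmul A m (balTmul A (MulOpposite.op a • n) v) =
          balTmul A m (balTmul A n (a • v))
        rw [balTmul_balanced]
      | hadd x y hx hy =>
        refine (congrArg _ (smul_add _ _ _)).trans ((map_add _ _ _).trans ?_)
        exact (congrArg₂ (· + ·) hx hy).trans (map_add _ _ _).symm)

/-- Associativity, backward direction. -/
def assocInv (M N : ABimodule R A) (V : Type w) [AddCommGroup V] [Module A V] :
    BalTensor A M.carrier (BalTensor A N.carrier V) →+ BalTensor A (M.tensor N).carrier V :=
  balLift
    (fun m y => balLift (fun n v => balTmul A (M := (M.tensor N).carrier) (balTmul A m n) v)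
      (fun n n' v => by
        rw [balTmul_add_right]
        exact balTmul_add_left (M := (M.tensor N).carrier) _ _ v)
      (fun n v v' => balTmul_add_right (M := (M.tensor N).carrier) _ v v')
      (fun a n v => balTmul_balanced (M := (M.tensor N).carrier) a (balTmul A m n) v) y)
    (fun m m' y => by
      induction y using bal_induction with
      | htmul n v =>
        exact (congrArg (fun x => balTmul A (M := (M.tensor N).carrier) x v)
          (balTmul_add_left m m' n)).trans (balTmul_add_left (M := (M.tensor N).carrier) _ _ v)
      | hadd x y hx hy =>
        rw [map_add, hx, hy, map_add, map_add]
        exact add_add_add_comm _ _ _ _)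
    (fun m y y' => map_add _ _ _)
    (fun a m y => by
      induction y using bal_induction with
      | htmul n v =>
        rw [smul_balTmul]
        exact congrArg (fun x => balTmul A (M := (M.tensor N).carrier) x v)
          (balTmul_balanced a m n)
      | hadd x y hx hy => rw [map_add, hx, hy, smul_add, map_add])

/-- Associativity, where the last factor is only a left module:
`(M ⊗_A N) ⊗_A V ≅ M ⊗_A (N ⊗_A V)`. -/
def assoc (M N : ABimodule R A) (V : Type w) [AddCommGroup V] [Module A V] :
    BalTensor A (M.tensor N).carrier V ≃ₗ[A] BalTensor A M.carrier (BalTensor A N.carrier V) where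
  toFun := assocHom M N V
  map_add' := map_add _
  map_smul' a z := by
    induction z using bal_induction with
    | htmul x v =>
      rw [smul_balTmul]
      exact map_smul (balMap (LinearMap.id : M.carrier →ₗ[A] M.carrier) (fun _ _ => rfl)
        (N.inLeft v)) a x
    | hadd x y hx hy =>
      rw [smul_add, map_add, map_add, hx, hy, smul_add]
  invFun := assocInv M N V
  left_inv z := by
    induction z using bal_induction with
    | htmul x v =>
      induction x using bal_induction with
      | htmul m n => rfl
      | hadd x y hx hy =>
        have h := balTmul_add_left (A := A) (M := (M.tensor N).carrier) x y v
        refine (congrArg (fun z => assocInv M N V (assocHom M N V z)) h).trans ?_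
        rw [map_add, map_add, hx, hy]
        exact h.symm
    | hadd x y hx hy => rw [map_add, map_add, hx, hy]
  right_inv z := by
    induction z using bal_induction with
    | htmul m y =>
      induction y using bal_induction with
      | htmul n v => rfl
      | hadd x y hx hy => rw [balTmul_add_right, map_add, map_add, hx, hy]
    | hadd x y hx hy => rw [map_add, map_add, hx, hy]

theorem right_add {X Y : ABimodule R A} (e : X.carrier →+ Y.carrier) (a : A) {x y : X.carrier}
    (hx : e (MulOpposite.op a • x) = MulOpposite.op a • e x)
    (hy : e (MulOpposite.op a • y) = MulOpposite.op a • e y) :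
    e (MulOpposite.op a • (x + y)) = MulOpposite.op a • e (x + y) := by
  rw [smul_add, map_add, map_add, smul_add, hx, hy]

theorem tensor_congr {M M' N N' : ABimodule R A} : Iso M M' → Iso N N' →
    Iso (M.tensor N) (M'.tensor N') := by
  rintro ⟨e, he⟩ ⟨f, hf⟩
  refine ⟨balCongr e he f, fun a x => ?_⟩
  induction x using bal_induction with
  | htmul m n =>
    change balTmul A (e m) (f (MulOpposite.op a • n)) =
      balTmul A (e m) (MulOpposite.op a • f n)
    rw [hf]
  | hadd x y hx hy =>
    exact right_add (X := M.tensor N) (Y := M'.tensor N')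
      ((balCongr e he f).toAddMonoidHom) a hx hy

theorem tensor_assoc (M N P : ABimodule R A) :
    Iso ((M.tensor N).tensor P) (M.tensor (N.tensor P)) := by
  refine ⟨assoc M N P.carrier, fun a z => ?_⟩
  induction z using bal_induction with
  | htmul x p =>
    induction x using bal_induction with
    | htmul m n => rfl
    | hadd x y hx hy =>
      have h : (balTmul A (M := (M.tensor N).carrier) (x + y) p : ((M.tensor N).tensor P).carrier) =
          balTmul A (M := (M.tensor N).carrier) x p + balTmul A (M := (M.tensor N).carrier) y p :=
        balTmul_add_left (A := A) (M := (M.tensor N).carrier) x y p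
      have h' := right_add (X := (M.tensor N).tensor P) (Y := M.tensor (N.tensor P))
        (assoc M N P.carrier).toAddMonoidHom a hx hy
      have key : ∀ z w : ((M.tensor N).tensor P).carrier, z = w →
          assoc M N P.carrier (MulOpposite.op a • w) =
            (show (M.tensor (N.tensor P)).carrier from
              MulOpposite.op a • (show (M.tensor (N.tensor P)).carrier from
                assoc M N P.carrier w)) →
          assoc M N P.carrier (MulOpposite.op a • z) =
            (show (M.tensor (N.tensor P)).carrier from
              MulOpposite.op a • (show (M.tensor (N.tensor P)).carrier from
                assoc M N P.carrier z)) := by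
        rintro _ _ rfl h
        exact h
      exact key _ _ h h'
  | hadd x y hx hy =>
    exact right_add (X := (M.tensor N).tensor P) (Y := M.tensor (N.tensor P))
      ((assoc M N P.carrier).toAddMonoidHom) a hx hy

theorem unit_tensor (M : ABimodule R A) : Iso ((unit R A).tensor M) M := by
  refine ⟨balUnitLeft (A := A) (V := M.carrier), fun a x => ?_⟩
  induction x using bal_induction with
  | htmul b m => exact smul_comm (show A from b) (MulOpposite.op a) m
  | hadd x y hx hy =>
    exact right_add (X := (unit R A).tensor M) (Y := M)
      ((balUnitLeft (A := A) (V := M.carrier)).toAddMonoidHom) a hx hy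

theorem tensor_unit (M : ABimodule R A) : Iso (M.tensor (unit R A)) M := by
  let F : BalTensor A M.carrier A →ₗ[A] M.carrier :=
    balLinear (balLift (fun (m : M.carrier) (a : A) => MulOpposite.op a • m)
      (fun m m' a => smul_add _ m m') (fun m a b => by rw [MulOpposite.op_add, add_smul])
      (fun a m b => by rw [smul_eq_mul, MulOpposite.op_mul, mul_smul]))
      (fun a m b => (smul_comm a (MulOpposite.op b) m).symm)
  let E : BalTensor A M.carrier A ≃ₗ[A] M.carrier :=
    LinearEquiv.ofLinearMap F
      { toFun := fun m => balTmul A m (1 : A)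
        map_add' := fun m m' => balTmul_add_left m m' 1
        map_smul' := fun a m => (smul_balTmul a m 1).symm }
      (by ext m; exact one_smul Aᵐᵒᵖ m)
      (bal_linear_ext (fun m a => by
        change balTmul A (MulOpposite.op a • m) (1 : A) = balTmul A m a
        rw [balTmul_balanced, smul_eq_mul, mul_one]))
  refine ⟨E, fun a x => ?_⟩
  induction x using bal_induction with
  | htmul m b => exact mul_smul (MulOpposite.op a) (MulOpposite.op b) m
  | hadd x y hx hy =>
    exact right_add (X := M.tensor (unit R A)) (Y := M)
      (E.toAddMonoidHom) a hx hy

/-- The set of isomorphism classes of `A`-`A`-bimodules. -/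
def Class (R : Type u) (A : Type v) [CommRing R] [Ring A] [Algebra R A] : Type (v + 1) :=
  Quotient (ABimodule.setoid (R := R) (A := A))

/-- The isomorphism class of a bimodule. -/
def toClass (M : ABimodule R A) : Class R A := Quotient.mk _ M

/-- Isomorphism classes of bimodules form a monoid under `⊗_A`, with neutral element the class of
the regular bimodule. -/
instance : Monoid (Class R A) where
  mul := Quotient.map₂ tensor (fun _ _ h _ _ h' => tensor_congr h h')
  one := toClass (unit R A)
  mul_assoc := by
    rintro ⟨M⟩ ⟨N⟩ ⟨P⟩
    exact Quotient.sound (tensor_assoc M N P)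
  one_mul := by
    rintro ⟨M⟩
    exact Quotient.sound (unit_tensor M)
  mul_one := by
    rintro ⟨M⟩
    exact Quotient.sound (tensor_unit M)

end ABimodule

/-- The Picard group of the `R`-algebra `A`: isomorphism classes of bimodules `M` that induce an
`R`-linear Morita auto-equivalence `M ⊗_A -` of `A`, that is, those for which there is a bimodule
`N` with `M ⊗_A N ≅ A ≅ N ⊗_A M`.  The product is `⊗_A`. -/
abbrev Pic (R : Type u) (A : Type v) [CommRing R] [Ring A] [Algebra R A] : Type (v + 1) :=
  (ABimodule.Class R A)ˣ

namespace ABimodule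

variable {R : Type u} {A : Type v} [CommRing R] [Ring A] [Algebra R A]

/-- `M ⊗_A V` is isomorphic to the left `A`-module `V`. -/
def Fixes (M : ABimodule R A) (V : Type w) [AddCommGroup V] [Module A V] : Prop :=
  Nonempty (BalTensor A M.carrier V ≃ₗ[A] V)

theorem Fixes.congr {M N : ABimodule R A} {V : Type w} [AddCommGroup V] [Module A V]
    (h : Iso M N) : M.Fixes V → N.Fixes V := by
  obtain ⟨e, he⟩ := h
  rintro ⟨f⟩
  exact ⟨(balCongr e he (LinearEquiv.refl A V)).symm.trans f⟩

theorem fixes_unit {V : Type w} [AddCommGroup V] [Module A V] : (unit R A).Fixes V :=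
  ⟨balUnitLeft (A := A) (V := V)⟩

theorem Fixes.tensor {M N : ABimodule R A} {V : Type w} [AddCommGroup V] [Module A V] :
    M.Fixes V → N.Fixes V → (M.tensor N).Fixes V := by
  rintro ⟨f⟩ ⟨g⟩
  exact ⟨((assoc M N V).trans (balCongr (LinearEquiv.refl A _) (fun _ _ => rfl) g)).trans f⟩

theorem Fixes.inv {M N : ABimodule R A} {V : Type w} [AddCommGroup V] [Module A V]
    (h : Iso (N.tensor M) (unit R A)) : M.Fixes V → N.Fixes V := by
  rintro ⟨f⟩
  obtain ⟨g⟩ : (N.tensor M).Fixes V := Fixes.congr h.symm fixes_unit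
  exact ⟨((balCongr (LinearEquiv.refl A _) (fun _ _ => rfl) f).symm.trans
    (assoc N M V).symm).trans g⟩

/-- For a ring homomorphism `φ : A → B`, the bimodule `M` fixes every simple `B`-module up to
isomorphism: `M ⊗_A V ≅ V`, where `A` acts on `V` through `φ`. -/
def FixesSimples {B : Type w} [Ring B] (φ : A →+* B) (M : ABimodule R A) : Prop :=
  ∀ (V : Type w) [AddCommGroup V] [Module B V] [IsSimpleModule B V],
    letI : Module A V := Module.compHom V φ
    M.Fixes V

end ABimodule

section Picent

variable (O : Type u) (K : Type v) (G : Type w) [CommRing O] [Field K] [Algebra O K] [Group G]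

/-- The group `Picent(OG)`: the subgroup of `Pic(OG)` of the classes of bimodules `M` that induce
the trivial permutation of `Irr(G)`.  Here `K` is the (sufficiently large) field of fractions of
`O`, the irreducible characters of `G` are afforded by the simple `KG`-modules `V`, and the
permutation is given by `V ↦ (K ⊗_O M) ⊗_{KG} V = M ⊗_{OG} V`.  Since both sides of
`M ⊗_{OG} V ≅ V` are vector spaces over the fraction field `K` of `O`, an isomorphism of
`OG`-modules is the same as one of `KG`-modules. -/
def Picent : Subgroup (Pic O (MonoidAlgebra O G)) where
  carrier := {c | ∃ M : ABimodule O (MonoidAlgebra O G), M.toClass = c.val ∧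
    M.FixesSimples (MonoidAlgebra.mapRingHom G (algebraMap O K))}
  one_mem' := ⟨ABimodule.unit _ _, rfl, fun V _ _ _ => by
    let _ : Module (MonoidAlgebra O G) V :=
      Module.compHom V (MonoidAlgebra.mapRingHom G (algebraMap O K))
    exact ABimodule.fixes_unit⟩
  mul_mem' := by
    rintro a b ⟨M, hM, hM'⟩ ⟨N, hN, hN'⟩
    refine ⟨M.tensor N, ?_, fun V _ _ _ => ?_⟩
    · rw [Units.val_mul, ← hM, ← hN]
      rfl
    · let _ : Module (MonoidAlgebra O G) V :=
        Module.compHom V (MonoidAlgebra.mapRingHom G (algebraMap O K))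
      exact ABimodule.Fixes.tensor (hM' V) (hN' V)
  inv_mem' := by
    rintro a ⟨M, hM, hM'⟩
    obtain ⟨N, hN⟩ := Quotient.exists_rep (a⁻¹).val
    refine ⟨N, hN, fun V _ _ _ => ?_⟩
    let _ : Module (MonoidAlgebra O G) V :=
      Module.compHom V (MonoidAlgebra.mapRingHom G (algebraMap O K))
    refine ABimodule.Fixes.inv (M := M) ?_ (hM' V)
    have h : (a⁻¹).val * a.val = 1 := a.inv_mul
    rw [← hM, ← hN] at h
    exact Quotient.exact h

end Picent

/-! ### Class-preserving automorphisms -/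

/-- `Aut_c(G)`: the automorphisms of `G` that leave every conjugacy class invariant. -/
def AutC (G : Type u) [Group G] : Subgroup (MulAut G) where
  carrier := {α | ∀ x, IsConj x (α x)}
  one_mem' x := IsConj.refl x
  mul_mem' {a b} ha hb x := (hb x).trans (ha (b x))
  inv_mem' {a} ha x := by
    have h := ha (a⁻¹ x)
    rw [MulAut.apply_inv_self] at h
    exact h.symm

/-- `Inn(G)`, as a subgroup of `Aut_c(G)`. -/
def InnC (G : Type u) [Group G] : Subgroup (AutC G) :=
  (MulAut.conj : G →* MulAut G).range.subgroupOf (AutC G)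

instance (G : Type u) [Group G] : (InnC G).Normal where
  conj_mem := by
    rintro ⟨_, _⟩ ⟨g, rfl⟩ a
    refine ⟨a.1 g, ?_⟩
    ext x
    simp

/-- `Out_c(G) = Aut_c(G) / Inn(G)`. -/
abbrev OutC (G : Type u) [Group G] : Type u := AutC G ⧸ InnC G

/-! ### The group `G = D ⋊ (⟨g⟩ ⋊ ⟨h⟩)` -/

section Construction

variable {F : Type u} [Field F]

/-- Multiplication by `c`, as an automorphism of the (multiplicatively written) additive group
of the field `F`. -/
def mulAut (c : Fˣ) : MulAut (Multiplicative F) :=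
  AddEquiv.toMultiplicative (DistribMulAction.toAddEquiv F c)

theorem mulAut_apply (c : Fˣ) (x : F) :
    mulAut c (Multiplicative.ofAdd x) = Multiplicative.ofAdd (c * x) := rfl

theorem mulAut_pow (a : Fˣ) (k : ℕ) : mulAut a ^ k = mulAut (a ^ k) := by
  induction k with
  | zero =>
    ext x
    change x = Multiplicative.ofAdd (((a ^ 0 : Fˣ) : F) * x.toAdd)
    simp
  | succ k ih =>
    ext x
    rw [pow_succ, ih, MulAut.mul_apply]
    change Multiplicative.ofAdd (((a ^ k : Fˣ) : F) * (a * x.toAdd)) =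
      Multiplicative.ofAdd (((a ^ (k + 1) : Fˣ) : F) * x.toAdd)
    rw [pow_succ, Units.val_mul, mul_assoc]

variable [Finite F] (p : ℕ) [Fact p.Prime] [CharP F p] (n : ℕ)

/-- The automorphism `x ↦ x ^ (p ^ n)` of the additive group of the finite field `F`. -/
noncomputable def frobAut : MulAut (Multiplicative F) :=
  AddEquiv.toMultiplicative (iterateFrobeniusEquiv F p n).toAddEquiv

theorem frobAut_apply (x : F) :
    frobAut p n (Multiplicative.ofAdd x) = Multiplicative.ofAdd (x ^ p ^ n) := rfl

/-- The relation `h g h⁻¹ = g ^ (p ^ n)`. -/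
theorem conj_mulAut (a b : Fˣ) :
    (frobAut p n * mulAut b) * mulAut a * (frobAut p n * mulAut b)⁻¹ = mulAut a ^ (p ^ n) := by
  rw [mul_inv_eq_iff_eq_mul, mulAut_pow]
  ext x
  change Multiplicative.ofAdd ((b * (a * x.toAdd)) ^ p ^ n) =
    Multiplicative.ofAdd (((a ^ p ^ n : Fˣ) : F) * (b * x.toAdd) ^ p ^ n)
  rw [Units.val_pow_eq_pow_val, ← mul_pow]
  ring_nf

theorem zpowers_le_normalizer (a b : Fˣ) :
    Subgroup.zpowers (frobAut p n * mulAut b) ≤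
      Subgroup.normalizer (Subgroup.zpowers (mulAut a) : Set (MulAut (Multiplicative F))) := by
  rw [Subgroup.zpowers_le]
  have : Finite (MulAut (Multiplicative F)) := DFunLike.finite _
  apply Subgroup.mem_normalizer_fintype
  rintro _ ⟨k, rfl⟩
  refine ⟨(p ^ n : ℕ) * k, ?_⟩
  change mulAut a ^ (((p ^ n : ℕ) : ℤ) * k) = _ * mulAut a ^ k * _
  rw [← conj_zpow, conj_mulAut, zpow_mul, zpow_natCast]

/-- The group `E = ⟨g⟩ ⋊ ⟨h⟩`, where `g` is multiplication by `a` and `h` is multiplication by `b`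
followed by `x ↦ x ^ (p ^ n)`; the cyclic group `⟨h⟩` acts on `⟨g⟩` by conjugation in the
automorphism group of `(F, +)`. -/
abbrev GroupE (a b : Fˣ) : Type u :=
  Subgroup.zpowers (mulAut a) ⋊[(Subgroup.zpowers (mulAut a)).normalizerMonoidHom.comp
    (Subgroup.inclusion (zpowers_le_normalizer p n a b))] Subgroup.zpowers (frobAut p n * mulAut b)

/-- The action of `E` on `D = (F, +)`, in which `⟨g⟩` and `⟨h⟩` act as the automorphisms that they
consist of. -/
noncomputable def actE (a b : Fˣ) : GroupE p n a b →* MulAut (Multiplicative F) :=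
  SemidirectProduct.monoidHomSubgroup (zpowers_le_normalizer p n a b)

/-- The group `G = D ⋊ E`. -/
abbrev GroupG (a b : Fˣ) : Type u :=
  Multiplicative F ⋊[actE p n a b] GroupE p n a b

end Construction

/-! Write `q = p ^ n`, so that `q ≡ 1` modulo `t ^ 2` and `s * t = 1 + q + ... + q ^ (t - 1)`.
Elements of `E` act on the field as `x ↦ a ^ i * b ^ j * x ^ (q ^ j)`. As `b ^ q = b`,
multiplication by `b` commutes with `E` and extends to `ψ`.

`ψ` preserves classes because `G` is a Frobenius group: `E` acts freely on nonzero elements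
(`dvd_and_pow_eq_one_of_fixed`), so for `e ≠ 1` the elements `(d, e)` with `e` fixed are conjugate
under `D`. On `D` itself, `b * d` lies in the `E`-orbit of `d` (`exists_semilinear_eq_mul`), but the
exponent `j` needed depends on `d`. No single element of `E` works for all `d`
(`not_forall_semilinear_eq_mul`).

The bimodule twisted by a class-preserving automorphism lies in `Picent` since such an automorphism
fixes all characters, and in characteristic zero these determine the simple modules
(`exists_equiv_of_class_preserving`). The class is trivial only if a unit of the group algebra
induces the automorphism. By Coleman's lemma (`exists_conj_of_unit`), an element of `G` would then
induce multiplication by `b` on the `p`-group `D`, which is impossible. Inner automorphisms give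
trivial bimodules, so it also follows that `ψ` is not inner. -/

/-! ### Twisted regular bimodules -/

namespace ABimodule

variable {R : Type u} {A : Type v} [CommRing R] [Ring A] [Algebra R A]

/-- The identification of the bimodule `_α A` with `A`. -/
def toTwist (α : A ≃ₐ[R] A) : A ≃+ (twist α).carrier := AddEquiv.refl A

/-- The identification of the bimodule `_α A` with `A`, backwards. -/
def ofTwist (α : A ≃ₐ[R] A) : (twist α).carrier ≃+ A := (toTwist α).symm

@[simp] theorem ofTwist_toTwist (α : A ≃ₐ[R] A) (m : A) : ofTwist α (toTwist α m) = m := rfl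

@[simp] theorem toTwist_ofTwist (α : A ≃ₐ[R] A) (m : (twist α).carrier) :
    toTwist α (ofTwist α m) = m := rfl

@[simp] theorem ofTwist_smul (α : A ≃ₐ[R] A) (a : A) (m : (twist α).carrier) :
    ofTwist α (a • m) = α a * ofTwist α m := rfl

@[simp] theorem ofTwist_op_smul (α : A ≃ₐ[R] A) (a : A) (m : (twist α).carrier) :
    ofTwist α (MulOpposite.op a • m) = ofTwist α m * a := rfl

theorem smul_toTwist (α : A ≃ₐ[R] A) (a m : A) : a • toTwist α m = toTwist α (α a * m) := rfl

theorem op_smul_toTwist (α : A ≃ₐ[R] A) (a m : A) :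
    MulOpposite.op a • toTwist α m = toTwist α (m * a) := rfl

theorem balTmul_toTwist_one (α : A ≃ₐ[R] A) {V : Type w} [AddCommGroup V] [Module A V]
    (m : (twist α).carrier) (v : V) :
    balTmul A (toTwist α 1) (ofTwist α m • v) = balTmul A m v := by
  rw [← balTmul_balanced, op_smul_toTwist, one_mul, toTwist_ofTwist]

/-- A bijection of `V` that intertwines the action twisted by `α` with the action identifies
`_α A ⊗_A V` with `V`. -/
theorem fixes_twist (α : A ≃ₐ[R] A) {V : Type w} [AddCommGroup V] [Module A V]
    (f : V ≃+ V) (hf : ∀ (a : A) v, f (α a • v) = a • f v) : (twist α).Fixes V := by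
  let T : BalTensor A (twist α).carrier V →ₗ[A] V :=
    balLinear (balLift (fun m v => f (ofTwist α m • v))
      (fun m m' v => by rw [map_add, add_smul, map_add])
      (fun m v v' => by rw [smul_add, map_add])
      (fun a m v => by rw [ofTwist_op_smul, mul_smul]))
      (fun a m v => by
        rw [balLift_tmul, balLift_tmul, ofTwist_smul, mul_smul, hf])
  have hT : ∀ m v, T (balTmul A m v) = f (ofTwist α m • v) := fun _ _ => rfl
  refine ⟨LinearEquiv.ofBijective T ⟨?_, fun v => ?_⟩⟩
  -- The inverse is `v ↦ 1 ⊗ f⁻¹ v`, because every tensor `m ⊗ v` equals `1 ⊗ m v`.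
  · have key : ∀ x, balTmul A (toTwist α 1) (f.symm (T x)) = x := by
      intro x
      induction x using bal_induction with
      | htmul m v => rw [hT, AddEquiv.symm_apply_apply, balTmul_toTwist_one]
      | hadd x y hx hy => rw [map_add, map_add, balTmul_add_right, hx, hy]
    exact fun x y h => by rw [← key x, h, key y]
  · refine ⟨balTmul A (toTwist α 1) (f.symm v), ?_⟩
    rw [hT, ofTwist_toTwist, one_smul, AddEquiv.apply_symm_apply]

theorem twist_refl : Iso (twist (AlgEquiv.refl : A ≃ₐ[R] A)) (unit R A) :=
  ⟨{ toFun := fun m => m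
     invFun := fun m => m
     map_add' := fun _ _ => rfl
     map_smul' := fun _ _ => rfl }, fun _ _ => rfl⟩

/-- The isomorphism is `m ⊗ n ↦ β(m) n`: applying `β` to the first factor makes it balanced, and a
left factor `a` comes out as `β(α(a))`. -/
theorem twist_tensor (α β : A ≃ₐ[R] A) :
    Iso ((twist α).tensor (twist β)) (twist (α.trans β)) := by
  let T : BalTensor A (twist α).carrier (twist β).carrier →ₗ[A] (twist (α.trans β)).carrier :=
    balLinear (balLift
        (fun m n => toTwist (α.trans β) (β (ofTwist α m) * ofTwist β n))
        (fun m m' n => by rw [map_add, map_add, add_mul, map_add])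
        (fun m n n' => by rw [map_add, mul_add, map_add])
        (fun a m n => by rw [ofTwist_op_smul, ofTwist_smul, map_mul β, mul_assoc]))
      (fun a m n => by
        rw [balLift_tmul, balLift_tmul, ofTwist_smul, map_mul β, mul_assoc, smul_toTwist]
        rfl)
  have hT : ∀ m n, T (balTmul A m n) =
    toTwist (α.trans β) (β (ofTwist α m) * ofTwist β n) := fun _ _ => rfl
  have hbij : Function.Bijective T := by
    constructor
    · have key : ∀ x, balTmul A (toTwist α 1)
          (toTwist β (ofTwist (α.trans β) (T x))) = x := by
        intro x
        induction x using bal_induction with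
        | htmul m n =>
          rw [hT, ofTwist_toTwist, ← balTmul_toTwist_one, ofTwist_toTwist, one_smul,
            ← balTmul_toTwist_one α m n]
          rfl
        | hadd x y hx hy => rw [map_add, map_add, map_add, balTmul_add_right, hx, hy]
      exact fun x y h => by rw [← key x, h, key y]
    · intro v
      refine ⟨balTmul A (toTwist α 1) (toTwist β (ofTwist (α.trans β) v)), ?_⟩
      rw [hT, ofTwist_toTwist, ofTwist_toTwist, map_one, one_mul, toTwist_ofTwist]
  refine ⟨LinearEquiv.ofBijective T hbij, fun a x => ?_⟩
  induction x using bal_induction with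
  | htmul m n =>
    change toTwist (α.trans β) (β (ofTwist α m) * (ofTwist β n * a)) =
      toTwist (α.trans β) (β (ofTwist α m) * ofTwist β n * a)
    rw [mul_assoc]
  | hadd x y hx hy =>
    exact right_add (X := (twist α).tensor (twist β)) (Y := twist (α.trans β))
      T.toAddMonoidHom a hx hy

/-- An inner automorphism gives the trivial bimodule. -/
theorem twist_iso_of_inner (α : A ≃ₐ[R] A) (c : Aˣ) (hc : ∀ x, c * α x = x * c) :
    Iso (twist α) (unit R A) := by
  refine Iso.trans ⟨{ toFun := fun m => toTwist AlgEquiv.refl (c * ofTwist α m)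
                      invFun := fun m => toTwist α (↑c⁻¹ * ofTwist AlgEquiv.refl m)
                      left_inv := fun m => by simp
                      right_inv := fun m => by simp
                      map_add' := fun m m' => by rw [map_add, mul_add, map_add]
                      map_smul' := fun a m => ?_ }, fun a m => ?_⟩ twist_refl
  · rw [ofTwist_smul, ← mul_assoc, hc, RingHom.id_apply, smul_toTwist, mul_assoc]
    rfl
  · change toTwist AlgEquiv.refl (c * (ofTwist α m * a)) =
      toTwist AlgEquiv.refl (c * ofTwist α m * a)
    rw [mul_assoc]

/-- If the bimodule `_α A` is isomorphic to `A`, then `α` is inner. -/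
theorem exists_unit_of_twist_iso (α : A ≃ₐ[R] A) (h : Iso (twist α) (unit R A)) :
    ∃ c : Aˣ, ∀ x, c * α x = x * c := by
  obtain ⟨e, he⟩ := h.trans twist_refl.symm
  let f : A → A := fun m => ofTwist AlgEquiv.refl (e (toTwist α m))
  -- A right-linear map is left multiplication by the image of `1`. Bijectivity makes this element a
  -- unit, and left linearity is the required relation.
  have hf : ∀ m, f m = f 1 * m := fun m => by
    change _ = ofTwist AlgEquiv.refl (MulOpposite.op m • e (toTwist α 1))
    rw [← he, op_smul_toTwist, one_mul]
  have hinj : Function.Injective f := fun x y h => e.injective h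
  obtain ⟨w, hw⟩ : ∃ w, f w = 1 := e.surjective (toTwist AlgEquiv.refl 1)
  have h1 : f 1 * w = 1 := (hf w).symm.trans hw
  have h2 : w * f 1 = 1 := hinj (by rw [hf, ← mul_assoc, h1, one_mul])
  refine ⟨⟨f 1, w, h1, h2⟩, fun x => ?_⟩
  change f 1 * α x = x * f 1
  rw [← hf]
  change _ = ofTwist AlgEquiv.refl (x • e (toTwist α 1))
  rw [← map_smul, smul_toTwist, mul_one]

/-- The class of `_α A` in the Picard group. -/
def twistHom (R : Type u) (A : Type v) [CommRing R] [Ring A] [Algebra R A] :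
    (A ≃ₐ[R] A) →* (Pic R A)ᵐᵒᵖ where
  toFun α := MulOpposite.op
    { val := (twist α).toClass
      inv := (twist α.symm).toClass
      val_inv := Quotient.sound ((twist_tensor α α.symm).trans (by
        rw [AlgEquiv.self_trans_symm]
        exact twist_refl))
      inv_val := Quotient.sound ((twist_tensor α.symm α).trans (by
        rw [AlgEquiv.symm_trans_self]
        exact twist_refl)) }
  map_one' := MulOpposite.unop_injective (Units.ext (Quotient.sound twist_refl))
  -- The product `α * β` applies `β` first, whereas tensoring composes from left to right; hence the
  -- opposite group.
  map_mul' α β := MulOpposite.unop_injective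
    (Units.ext (Quotient.sound (twist_tensor β α).symm))

end ABimodule

/-! ### Class-preserving automorphisms fix the simple modules -/

section Characters

/-- Over a field of characteristic zero, the twist of a nonzero representation by a
class-preserving automorphism admits a nonzero intertwining map from the representation. -/
theorem exists_intertwining_of_class_preserving {K G V : Type*} [Field K] [CharZero K] [Group G]
    [Finite G] [AddCommGroup V] [Module K V] [FiniteDimensional K V] [Nontrivial V]
    (ρ : Representation K G V) (σ : MulAut G) (hσ : ∀ x, IsConj x (σ x)) :
    ∃ T : V →ₗ[K] V, T ≠ 0 ∧ ∀ g v, T (ρ (σ g) v) = ρ g (T v) := by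
  have := Fintype.ofFinite G
  have hcard : (Nat.card G : K) ≠ 0 := Nat.cast_ne_zero.2 Nat.card_pos.ne'
  let := invertibleOfNonzero hcard
  let ρ' : Representation K G V := ρ.comp (σ : G →* G)
  have hchar : ρ'.character = ρ.character := by
    ext g
    obtain ⟨c, hc⟩ := isConj_iff.1 (hσ g)
    change ρ.character (σ g) = _
    rw [← hc, Representation.char_conj]
  -- The averaged product of characters is the dimension of a space of intertwining maps, so equal
  -- characters give `dim Hom(ρ', ρ) = dim End(ρ)`, which is positive because of the identity.
  have h1 := Representation.card_inv_mul_sum_char_mul_char_eq_finrank ρ' ρ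
  have h2 := Representation.card_inv_mul_sum_char_mul_char_eq_finrank ρ ρ
  rw [hchar, h2, Nat.cast_inj] at h1
  have : Nontrivial (ρ.IntertwiningMap ρ) := by
    refine ⟨0, Representation.IntertwiningMap.id ρ, fun h => ?_⟩
    obtain ⟨v, hv⟩ := exists_ne (0 : V)
    exact hv (congrArg (fun f : ρ.IntertwiningMap ρ => f v) h).symm
  have hpos : 0 < Module.finrank K (ρ.IntertwiningMap ρ) := Module.finrank_pos
  rw [h1] at hpos
  have := Module.nontrivial_of_finrank_pos hpos
  obtain ⟨T, hT⟩ := exists_ne (0 : ρ'.IntertwiningMap ρ)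
  refine ⟨T.toLinearMap, fun h => hT (Representation.IntertwiningMap.ext h),
    fun g v => LinearMap.congr_fun (T.isIntertwining' g) v⟩

/-- Schur's argument: the kernel of a nonzero intertwining map is a submodule of a simple module,
hence zero, and an injective endomorphism of a finite-dimensional space is bijective. -/
theorem exists_equiv_of_class_preserving {K : Type u} {G : Type v} [Field K] [CharZero K] [Group G]
    [Finite G] {V : Type w} [AddCommGroup V] [Module (MonoidAlgebra K G) V]
    [IsSimpleModule (MonoidAlgebra K G) V] (σ : MulAut G) (hσ : ∀ x, IsConj x (σ x)) :
    ∃ f : V ≃+ V, ∀ (x : MonoidAlgebra K G) v,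
      f (MonoidAlgebra.domCongr K K σ x • v) = x • f v := by
  let _ : Module K V := Module.compHom V (algebraMap K (MonoidAlgebra K G))
  have : IsScalarTower K (MonoidAlgebra K G) V := ⟨fun c x v => by
    rw [Algebra.smul_def, mul_smul]; rfl⟩
  have : Module.Finite K (MonoidAlgebra K G) := by
    infer_instance
  have : Module.Finite (MonoidAlgebra K G) V := inferInstance
  have : Module.Finite K V := Module.Finite.trans (MonoidAlgebra K G) V
  have : Nontrivial V := IsSimpleModule.nontrivial (MonoidAlgebra K G) V
  let ρ : Representation K G V := Representation.ofModule' V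
  have hρ : ∀ g v, ρ g v = MonoidAlgebra.single g (1 : K) • v := fun g v => rfl
  obtain ⟨T, hT0, hT⟩ := exists_intertwining_of_class_preserving ρ σ hσ
  have hTx : ∀ (x : MonoidAlgebra K G) v, T (MonoidAlgebra.domCongr K K σ x • v) = x • T v := by
    intro x v
    induction x using MonoidAlgebra.induction_on with
    | of g =>
      have := hT g v
      rw [hρ, hρ] at this
      simpa using this
    | add x y hx hy => rw [map_add, add_smul, map_add, hx, hy, add_smul]
    | smul c x hx =>
      rw [map_smul (MonoidAlgebra.domCongr K K σ), smul_assoc, map_smul T, hx, smul_assoc]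
  let N : Submodule (MonoidAlgebra K G) V :=
    { carrier := {v | T v = 0}
      zero_mem' := map_zero T
      add_mem' := fun {a b} ha hb => by
        change T (a + b) = 0
        rw [map_add, show T a = 0 from ha, show T b = 0 from hb, add_zero]
      smul_mem' := fun x v hv => by
        -- `T` is only semilinear with respect to `σ`, so the scalar is first written as the image
        -- of some `y`.
        obtain ⟨y, rfl⟩ := (MonoidAlgebra.domCongr K K σ).surjective x
        change T _ = 0
        rw [hTx, show T v = 0 from hv, smul_zero] }
  have hN : N = ⊥ := (eq_bot_or_eq_top N).resolve_right fun h => hT0 (LinearMap.ext fun v => by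
    have : v ∈ N := h ▸ Submodule.mem_top
    exact this)
  have hinj : Function.Injective T := (injective_iff_map_eq_zero T).2 fun v hv => by
    have : v ∈ N := hv
    rwa [hN, Submodule.mem_bot] at this
  exact ⟨AddEquiv.ofBijective T ⟨hinj, LinearMap.injective_iff_surjective.1 hinj⟩, hTx⟩

end Characters

/-! ### Units inducing automorphisms, restricted to a `p`-subgroup -/

section Coleman

/-- A function on a finite set that is constant on the orbits of a `p`-group and has nonzero sum in
characteristic `p` forces a fixed point. -/
theorem IsPGroup.exists_fixed_of_sum_ne_zero {P X k : Type*} [Group P] [MulAction P X] [Fintype X]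
    [CommRing k] (p : ℕ) [Fact p.Prime] [CharP k p] (hP : IsPGroup p P) (f : X → k)
    (hf : ∀ (d : P) x, f (d • x) = f x) (hsum : ∑ x, f x ≠ 0) :
    (MulAction.fixedPoints P X).Nonempty := by
  classical
  by_contra hne
  apply hsum
  -- Each level set of `f` is stable under `P`. Without fixed points its size is divisible by `p`,
  -- so it contributes zero to the sum.
  rw [← Finset.sum_fiberwise_of_maps_to (fun x _ => Finset.mem_image_of_mem f (Finset.mem_univ x))]
  refine Finset.sum_eq_zero fun c _ => ?_
  rw [Finset.sum_congr rfl (g := fun _ => c) (fun x hx => (Finset.mem_filter.1 hx).2),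
    Finset.sum_const]
  let S : SubMulAction P X := ⟨{x | f x = c}, fun d x hx => (hf d x).trans hx⟩
  have h := hP.card_modEq_card_fixedPoints S
  have h0 : Nat.card (MulAction.fixedPoints P S) = 0 := by
    have : IsEmpty (MulAction.fixedPoints P S) := ⟨fun x => hne ⟨x.1.1, fun d =>
      congrArg Subtype.val (x.2 d)⟩⟩
    exact Nat.card_of_isEmpty
  have hS : Nat.card S = (Finset.univ.filter fun x => f x = c).card := by
    rw [← Fintype.card_subtype, ← Nat.card_eq_fintype_card]
    rfl
  rw [h0, hS, Nat.modEq_zero_iff_dvd] at h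
  rw [nsmul_eq_mul, (CharP.cast_eq_zero_iff k p _).2 h, zero_mul]

/-- Coleman's lemma: two homomorphisms from a `p`-group to `G` that are conjugate by a unit of the
group algebra over a local ring of residue characteristic `p` are conjugate in `G`. -/
theorem exists_conj_of_unit {O G P : Type*} [CommRing O] [IsLocalRing O] (p : ℕ) [Fact p.Prime]
    [CharP (IsLocalRing.ResidueField O) p] [Group G] [Finite G] [Group P] (hP : IsPGroup p P)
    (φ ψ : P →* G) (c : (MonoidAlgebra O G)ˣ)
    (hc : ∀ d, (c : MonoidAlgebra O G) * MonoidAlgebra.single (ψ d) 1 =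
      MonoidAlgebra.single (φ d) 1 * (c : MonoidAlgebra O G)) :
    ∃ x : G, ∀ d, φ d * x = x * ψ d := by
  have := Fintype.ofFinite G
  -- A fixed point of this twisted conjugation is exactly an element with the desired property.
  let _ : MulAction P G :=
    { smul := fun d x => φ d * x * (ψ d)⁻¹
      one_smul := fun x => by change φ 1 * x * (ψ 1)⁻¹ = x; simp
      mul_smul := fun d d' x => by
        change φ (d * d') * x * (ψ (d * d'))⁻¹ = φ d * (φ d' * x * (ψ d')⁻¹) * (ψ d)⁻¹
        simp [mul_assoc] }
  have hsmul : ∀ (d : P) (x : G), d • x = φ d * x * (ψ d)⁻¹ := fun _ _ => rfl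
  -- The augmentation of a unit is a unit, so the coefficients of `c` have nonzero sum in the
  -- residue field.
  let ε : MonoidAlgebra O G →ₐ[O] O := MonoidAlgebra.lift O O G 1
  have hε : ∀ y, ε y = ∑ x, y.coeff x := fun y => by
    simp [ε, MonoidAlgebra.lift_apply, Finsupp.sum_fintype]
  obtain ⟨x, hx⟩ := hP.exists_fixed_of_sum_ne_zero (X := G) p
    (fun x => IsLocalRing.residue O ((c : MonoidAlgebra O G).coeff x)) (fun d x => by
      -- Comparing coefficients at `φ d * x` shows that those of `c` are constant on orbits.
      have h := congrArg (fun y : MonoidAlgebra O G => y.coeff (φ d * x)) (hc d)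
      simp only [MonoidAlgebra.coeff_single_mul_apply,
        MonoidAlgebra.coeff_mul_single_apply] at h
      simp only [hsmul]
      simpa using congrArg (IsLocalRing.residue O) h) (by
      rw [← map_sum, ← hε]
      exact ((c.isUnit.map ε).map (IsLocalRing.residue O)).ne_zero)
  refine ⟨x, fun d => ?_⟩
  exact mul_inv_eq_iff_eq_mul.1 (hx d)

end Coleman

/-! ### Semilinear maps `x ↦ c x ^ (q ^ j)` of a finite field -/

section FieldArithmetic

theorem geom_sum_modEq {r M : ℕ} (h : r ≡ 1 [MOD M]) (m : ℕ) :
    ∑ k ∈ Finset.range m, r ^ k ≡ m [MOD M] := by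
  induction m with
  | zero => rfl
  | succ m ih =>
    rw [Finset.sum_range_succ]
    simpa using ih.add (h.pow m)

/-- Each of the `t` summands is `1` modulo `t ^ 2`, so `s * t ≡ t` modulo `t ^ 2`; cancelling `t`
leaves `s ≡ 1` modulo `t`. -/
theorem coprime_of_mul_eq_geom_sum {q t s : ℕ} (ht : 1 < t) (hq : q ≡ 1 [MOD t ^ 2])
    (hs : s * t = ∑ k ∈ Finset.range t, q ^ k) : s.Coprime t := by
  have h : s * t ≡ 1 * t [MOD t * t] := by
    rw [hs, one_mul, ← pow_two]
    exact geom_sum_modEq hq t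
  have h' : s ≡ 1 [MOD t] := Nat.ModEq.mul_right_cancel' (by omega) h
  rw [Nat.Coprime, h'.gcd_eq, Nat.gcd_one_left]

theorem IsPrimitiveRoot.exists_units_pow_eq {R : Type*} [CommRing R] [IsDomain R] {k : ℕ}
    [NeZero k] {ζ ξ : Rˣ} (h : IsPrimitiveRoot ζ k) (hξ : ξ ^ k = 1) : ∃ i : ℕ, ζ ^ i = ξ := by
  obtain ⟨i, -, hi⟩ := (IsPrimitiveRoot.coe_units_iff.2 h).eq_pow_of_pow_eq_one
    (ξ := (ξ : R)) (by rw [← Units.val_pow_eq_pow_val, hξ, Units.val_one])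
  exact ⟨i, Units.ext (by rw [Units.val_pow_eq_pow_val, hi])⟩

variable {F : Type*} [Field F] {q t s : ℕ}

theorem pow_pow_mul_of_card [Finite F] (hF : Nat.card F = q ^ t) (x : F) (m : ℕ) : x ^ q ^ (t * m) = x := by
  have := Fintype.ofFinite F
  rw [pow_mul, ← hF, Nat.card_eq_fintype_card, FiniteField.pow_card_pow]

variable {a b : Fˣ} (ht : 1 < t) (hq1 : 1 < q) (hq : q ≡ 1 [MOD t ^ 2])
  (hs : s * t = ∑ k ∈ Finset.range t, q ^ k) (hF : Nat.card F = q ^ t)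
  (ha : IsPrimitiveRoot a s) (hb : IsPrimitiveRoot b (t ^ 2))

include hF in
theorem units_pow_card_pow_sub_one (x : Fˣ) : x ^ (q ^ t - 1) = 1 := by
  rw [← hF, ← Nat.card_units]
  exact pow_card_eq_one'

variable [Finite F]

include ht hq1 hq hs hF ha hb in
/-- The maps `x ↦ a ^ i b ^ j x ^ (q ^ j)` act freely on the nonzero elements. -/
theorem dvd_and_pow_eq_one_of_fixed (v : Fˣ) (i j : ℕ)
    (h : a ^ i * b ^ j * v ^ q ^ j = v) : t ^ 2 ∣ j ∧ a ^ i = 1 := by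
  have hst := coprime_of_mul_eq_geom_sum ht hq hs
  have hst2 : (t ^ 2).Coprime s := (hst.pow_right 2).symm
  -- Exponents divisible by `s` remove the contribution of `a`.
  have hpow : ∀ m : ℕ, (a ^ i * b ^ j) ^ (s * m) = b ^ (j * (s * m)) := fun m => by
    rw [mul_pow, ← pow_mul, ← pow_mul, show i * (s * m) = s * (i * m) by ring, pow_mul a s,
      ha.pow_eq_one, one_pow, one_mul]
  have hr : q ^ j ≡ 1 [MOD t ^ 2] := by simpa using hq.pow j
  have hr1 : 1 ≤ q ^ j := Nat.one_le_pow _ _ (by omega)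
  have hv : v ^ (q ^ j - 1) = (a ^ i * b ^ j)⁻¹ := by
    rw [eq_inv_iff_mul_eq_one, ← mul_right_inj v, mul_one, ← mul_assoc, ← pow_succ',
      Nat.sub_add_cancel hr1, mul_comm, h]
  have hdvd : q ^ t - 1 ∣ (q ^ j) ^ t - 1 := by
    rw [← pow_mul, mul_comm, pow_mul]
    simpa using Nat.sub_dvd_pow_sub_pow (q ^ t) 1 j
  -- The inverse of the base is `v ^ (q ^ j - 1)`, so the geometric sum telescopes to the exponent
  -- `q ^ (j * t) - 1`, a multiple of the order of the unit group.
  have hc : (a ^ i * b ^ j) ^ (∑ k ∈ Finset.range t, (q ^ j) ^ k) = 1 := by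
    rw [← inv_eq_one, ← inv_pow, ← hv, ← pow_mul, mul_comm, geom_sum_mul_of_one_le hr1]
    obtain ⟨m, hm⟩ := hdvd
    rw [hm, pow_mul, units_pow_card_pow_sub_one hF, one_pow]
  have hbS : b ^ (j * (s * ∑ k ∈ Finset.range t, (q ^ j) ^ k)) = 1 := by
    rw [← hpow, mul_comm s, pow_mul, hc, one_pow]
  -- The geometric sum is `t` modulo `t ^ 2`, so this first pass yields only `t ∣ j`. Then the
  -- Frobenius power is trivial, `a ^ i * b ^ j = 1`, and an `s`-th power gives the full
  -- divisibility.
  have h1 : t ^ 2 ∣ j * t * s := by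
    have h2 := hb.dvd_of_pow_eq_one _ hbS
    have h3 := (geom_sum_modEq hr t).mul_left (j * s)
    rw [show j * t * s = j * s * t by ring]
    rw [← mul_assoc] at h2
    exact (h3.dvd_iff dvd_rfl).1 h2
  have h2 : t ∣ j := by
    have h3 := hst2.dvd_of_dvd_mul_right h1
    rw [pow_two] at h3
    exact Nat.dvd_of_mul_dvd_mul_right (by omega) h3
  obtain ⟨m, rfl⟩ := h2
  have hvq : v ^ q ^ (t * m) = v := Units.ext (by
    rw [Units.val_pow_eq_pow_val, pow_pow_mul_of_card hF])
  rw [hvq, mul_eq_right] at h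
  have h4 := hpow 1
  rw [h, one_pow, mul_one] at h4
  have h5 := hst2.dvd_of_dvd_mul_right (hb.dvd_of_pow_eq_one _ h4.symm)
  refine ⟨h5, ?_⟩
  rwa [(hb.pow_eq_one_iff_dvd _).2 h5, mul_one] at h

include ht hq1 hq hs hF ha hb in
/-- The orbits of the maps `x ↦ a ^ i b ^ j x ^ (q ^ j)` are stable under multiplication by `b`. -/
theorem exists_semilinear_eq_mul (d : Fˣ) : ∃ i j : ℕ, a ^ i * b ^ j * d ^ q ^ j = b * d := by
  have hst := coprime_of_mul_eq_geom_sum ht hq hs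
  have hs0 : s ≠ 0 := by
    rintro rfl
    rw [Nat.coprime_zero_left] at hst
    omega
  have hβ : IsPrimitiveRoot (b ^ s) (t ^ 2) := hb.pow_of_coprime s (hst.pow_right 2)
  have hβt : IsPrimitiveRoot ((b ^ s) ^ t) t := hβ.pow (by positivity) (pow_two t)
  have hgeom : ∀ m, (∑ k ∈ Finset.range m, q ^ k) * (q - 1) = q ^ m - 1 := fun m =>
    geom_sum_mul_of_one_le hq1.le m
  -- Put `β = b ^ s` and `u = d ^ (s * (q - 1))`. A suitable `i` exists once the `s`-th powers of
  -- both sides agree without the factor `a ^ i`, that is, once `β ^ j * u ^ j = β`. Since `u` is a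
  -- `t`-th root of unity, `u = β ^ (t * k)`, and `j` must invert `1 + t * k` modulo `t ^ 2`.
  have hut : (d ^ (s * (q - 1))) ^ t = 1 := by
    rw [← pow_mul, show s * (q - 1) * t = s * t * (q - 1) by ring, hs, hgeom,
      units_pow_card_pow_sub_one hF]
  have : NeZero t := ⟨by omega⟩
  have : NeZero s := ⟨hs0⟩
  obtain ⟨k, hk⟩ := hβt.exists_units_pow_eq hut
  have hcop : (1 + t * k).Coprime (t ^ 2) := by
    refine Nat.Coprime.pow_right 2 ?_
    simp
  obtain ⟨j, hj⟩ := Nat.exists_mul_mod_eq_one_of_coprime hcop (Nat.one_lt_pow two_ne_zero ht)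
  have hj' : (1 + t * k) * j ≡ 1 [MOD t ^ 2] := by
    rw [Nat.ModEq, hj.2, Nat.mod_eq_of_lt (Nat.one_lt_pow two_ne_zero ht)]
  -- Here `u ^ t = 1` and `q ≡ 1` modulo `t`, so the geometric sum may be replaced by its number of
  -- terms.
  have huS : (d ^ (s * (q - 1))) ^ (∑ l ∈ Finset.range j, q ^ l) = (d ^ (s * (q - 1))) ^ j :=
    pow_eq_pow_iff_modEq.2 ((geom_sum_modEq (hq.of_dvd (Dvd.intro_left _ (pow_two t).symm)) j).of_dvd
      (orderOf_dvd_of_pow_eq_one hut))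
  have hd : (d ^ q ^ j) ^ s = d ^ s * (d ^ (s * (q - 1))) ^ j := by
    rw [← huS, ← pow_mul, ← pow_mul, ← pow_add, show s * (q - 1) * ∑ l ∈ Finset.range j, q ^ l =
      s * ((∑ l ∈ Finset.range j, q ^ l) * (q - 1)) by ring, hgeom]
    congr 1
    have : 1 ≤ q ^ j := Nat.one_le_pow _ _ (by omega)
    zify [this]
    ring
  have hbj : (b ^ s) ^ j * (d ^ (s * (q - 1))) ^ j = b ^ s := by
    rw [← hk, ← mul_pow, ← pow_mul _ t, ← pow_succ', add_comm, ← pow_mul (b ^ s)]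
    conv_rhs => rw [← pow_one (b ^ s)]
    exact pow_eq_pow_iff_modEq.2 (hβ.eq_orderOf ▸ hj')
  obtain ⟨i, hi⟩ := ha.exists_units_pow_eq (ξ := b * d * (b ^ j * d ^ q ^ j)⁻¹) (by
    rw [mul_pow, inv_pow, mul_inv_eq_one, mul_pow, mul_pow, hd, ← pow_mul b j, mul_comm j,
      pow_mul b s]
    nth_rewrite 1 [← hbj]
    exact mul_right_comm _ _ _ |>.trans (mul_assoc _ _ _) |>.trans (by ac_rfl))
  exact ⟨i, j, by rw [mul_assoc, hi, inv_mul_cancel_right]⟩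

include ht hq1 hq hs hF ha hb in
/-- Multiplication by `b` is not one of the maps `x ↦ a ^ i b ^ j x ^ (q ^ j)`. -/
theorem not_forall_semilinear_eq_mul (i j : ℕ) :
    ¬ ∀ x : Fˣ, a ^ i * b ^ j * x ^ q ^ j = b * x := by
  intro h
  have hst := coprime_of_mul_eq_geom_sum ht hq hs
  have hβ : IsPrimitiveRoot (b ^ s) (t ^ 2) := hb.pow_of_coprime s (hst.pow_right 2)
  have h1 : a ^ i * b ^ j = b := by simpa using h 1
  -- Evaluating at `1` forces the coefficient to be `b`, so the Frobenius power is trivial. Yet `j ≡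
  -- 1` modulo `t` makes that power `x ↦ x ^ q`, which is nontrivial because `t > 1`.
  have hx : ∀ x : Fˣ, x ^ q ^ j = x := fun x => by
    have := h x
    rwa [h1, mul_right_inj] at this
  have h2 : (b ^ s) ^ j = b ^ s := by
    conv_rhs => rw [← h1]
    rw [mul_pow, ← pow_mul, ← pow_mul, ← pow_mul, mul_comm i, pow_mul a, ha.pow_eq_one, one_pow,
      one_mul, mul_comm]
  have h3 : j ≡ 1 [MOD t ^ 2] := by
    conv_rhs at h2 => rw [← pow_one (b ^ s)]
    exact hβ.eq_orderOf ▸ pow_eq_pow_iff_modEq.1 h2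
  have h4 : j % t = 1 := by
    have := h3.of_dvd (Dvd.intro_left _ (pow_two t).symm)
    rwa [Nat.ModEq, Nat.mod_eq_of_lt ht] at this
  obtain ⟨v, hv⟩ := IsCyclic.exists_generator (α := Fˣ)
  have hv' := orderOf_eq_card_of_forall_mem_zpowers hv
  rw [Nat.card_units, hF] at hv'
  have h5 : v ^ (q - 1) = 1 := by
    have h6 := hx v
    rw [← Nat.div_add_mod j t, h4, pow_succ, pow_mul] at h6
    have h7 : v ^ q ^ (t * (j / t)) = v := Units.ext (by
      rw [Units.val_pow_eq_pow_val, pow_pow_mul_of_card hF])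
    rw [h7] at h6
    rw [← mul_left_inj v, ← pow_succ, Nat.sub_add_cancel hq1.le, h6, one_mul]
  have h6 := Nat.le_of_dvd (by omega) (orderOf_dvd_of_pow_eq_one h5)
  rw [hv'] at h6
  have h7 := Nat.pow_lt_pow_right hq1 ht
  rw [pow_one] at h7
  omega

end FieldArithmetic

/-! ### The group `G = D ⋊ (⟨g⟩ ⋊ ⟨h⟩)` is a Frobenius group with a class-preserving automorphism -/

section FrobeniusGroup

variable {F : Type u} [Field F] [Finite F] (p : ℕ) [Fact p.Prime] [CharP F p] (n : ℕ)

/-- Since the Frobenius power fixes `b`, its two factors commute and powers can be taken separately.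
-/
theorem frobAut_mul_mulAut_pow_apply {b : Fˣ} (hb : b ^ p ^ n = b) (j : ℕ) (x : F) :
    ((frobAut p n * mulAut b) ^ j : MulAut (Multiplicative F)) (Multiplicative.ofAdd x) =
      Multiplicative.ofAdd (((b ^ j : Fˣ) : F) * x ^ (p ^ n) ^ j) := by
  induction j generalizing x with
  | zero => simp
  | succ j ih =>
    rw [pow_succ, MulAut.mul_apply, MulAut.mul_apply, mulAut_apply, frobAut_apply, ih, mul_pow,
      ← Units.val_pow_eq_pow_val, hb, mul_pow, ← pow_mul x, ← pow_succ', ← mul_assoc,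
      ← Units.val_pow_eq_pow_val, ← Units.val_mul]
    congr 4
    have : ∀ k, b ^ (p ^ n) ^ k = b := fun k => by
      induction k with
      | zero => simp
      | succ k ih => rw [pow_succ, pow_mul, ih, hb]
    rw [this, ← pow_succ]

theorem actE_mk {a b : Fˣ} (x : Subgroup.zpowers (mulAut a))
    (y : Subgroup.zpowers (frobAut p n * mulAut b)) : actE p n a b ⟨x, y⟩ = x.1 * y.1 := rfl

instance finite_groupE (a b : Fˣ) : Finite (GroupE p n a b) :=
  have : Finite (MulAut (Multiplicative F)) := DFunLike.finite _
  Finite.of_equiv _ SemidirectProduct.equivProd.symm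

instance finite_groupG (a b : Fˣ) : Finite (GroupG p n a b) :=
  Finite.of_equiv _ SemidirectProduct.equivProd.symm

theorem exists_actE_apply {a b : Fˣ} (hb : b ^ p ^ n = b) (i j : ℕ) :
    ∃ e : GroupE p n a b, ∀ x : F, actE p n a b e (Multiplicative.ofAdd x) =
      Multiplicative.ofAdd (((a ^ i * b ^ j : Fˣ) : F) * x ^ (p ^ n) ^ j) :=
  ⟨⟨⟨mulAut a ^ i, Subgroup.npow_mem_zpowers _ i⟩, ⟨_, Subgroup.npow_mem_zpowers _ j⟩⟩, fun x => by
    rw [actE_mk, MulAut.mul_apply]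
    dsimp only
    rw [frobAut_mul_mulAut_pow_apply p n hb, mulAut_pow, mulAut_apply, ← mul_assoc,
      Units.val_mul]⟩

/-- Finiteness permits natural exponents, which translates statements about `E` into the field
arithmetic above. -/
theorem exists_eq_of_groupE {a b : Fˣ} (hb : b ^ p ^ n = b) (e : GroupE p n a b) :
    ∃ i j : ℕ, e.left.1 = mulAut a ^ i ∧ e.right.1 = (frobAut p n * mulAut b) ^ j ∧
      ∀ x : F, actE p n a b e (Multiplicative.ofAdd x) =
        Multiplicative.ofAdd (((a ^ i * b ^ j : Fˣ) : F) * x ^ (p ^ n) ^ j) := by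
  have : Finite (MulAut (Multiplicative F)) := DFunLike.finite _
  obtain ⟨⟨_, hx⟩, ⟨_, hy⟩⟩ := e
  obtain ⟨i, rfl⟩ := mem_powers_iff_mem_zpowers.2 hx
  obtain ⟨j, rfl⟩ := mem_powers_iff_mem_zpowers.2 hy
  refine ⟨i, j, rfl, rfl, fun x => ?_⟩
  rw [actE_mk, MulAut.mul_apply]
  dsimp only
  rw [frobAut_mul_mulAut_pow_apply p n hb, mulAut_pow, mulAut_apply,
      ← mul_assoc, Units.val_mul]

theorem mulAut_comm_actE {a b : Fˣ} (hb : b ^ p ^ n = b) (e : GroupE p n a b)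
    (d : Multiplicative F) : mulAut b (actE p n a b e d) = actE p n a b e (mulAut b d) := by
  obtain ⟨i, j, -, -, h⟩ := exists_eq_of_groupE p n hb e
  have hbj : ∀ k, b ^ (p ^ n) ^ k = b := fun k => by
    induction k with
    | zero => simp
    | succ k ih => rw [pow_succ, pow_mul, ih, hb]
  change mulAut b (actE p n a b e (Multiplicative.ofAdd d.toAdd)) =
    actE p n a b e (Multiplicative.ofAdd (b * d.toAdd))
  rw [h, h, mulAut_apply, mul_pow, ← Units.val_pow_eq_pow_val b, hbj, mul_left_comm]

/-- The automorphism of `G` that acts on `D` as multiplication by `b` and trivially on `E`. -/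
noncomputable def psiG {a b : Fˣ} (hb : b ^ p ^ n = b) : MulAut (GroupG p n a b) :=
  SemidirectProduct.congr (mulAut b) (MulEquiv.refl _)
    (fun e => MulEquiv.ext fun d => mulAut_comm_actE p n hb e d)

theorem psiG_mk {a b : Fˣ} (hb : b ^ p ^ n = b) (d : Multiplicative F) (e : GroupE p n a b) :
    psiG p n hb ⟨d, e⟩ = ⟨mulAut b d, e⟩ := rfl

variable {p n} {t s : ℕ} {a b : Fˣ} (ht : 1 < t) (hq1 : 1 < p ^ n) (hq : p ^ n ≡ 1 [MOD t ^ 2])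
  (hs : s * t = ∑ k ∈ Finset.range t, (p ^ n) ^ k) (hF : Nat.card F = (p ^ n) ^ t)
  (ha : IsPrimitiveRoot a s) (hb : IsPrimitiveRoot b (t ^ 2))

include hq hb in
omit [Finite F] [Fact p.Prime] [CharP F p] in
theorem pow_card_eq_self_of_modEq : b ^ p ^ n = b := by
  conv_rhs => rw [← pow_one b]
  exact pow_eq_pow_iff_modEq.2 (hb.eq_orderOf ▸ hq)

include ht hq1 hq hs hF ha hb in
/-- `E` acts freely on `D \ {0}`. -/
theorem eq_one_of_actE_apply_eq (e : GroupE p n a b) (d : Multiplicative F) (hd : d ≠ 1)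
    (h : actE p n a b e d = d) : e = 1 := by
  obtain ⟨i, j, hl, hr, hact⟩ := exists_eq_of_groupE p n (pow_card_eq_self_of_modEq hq hb) e
  have hbq := pow_card_eq_self_of_modEq hq hb
  obtain ⟨h1, h2⟩ := dvd_and_pow_eq_one_of_fixed ht hq1 hq hs hF ha hb (Units.mk0 d.toAdd hd) i j
    (Units.ext ((hact d.toAdd).symm.trans h))
  -- An element of `E` is a pair of automorphisms, not their product, so both components must be
  -- shown trivial.
  refine SemidirectProduct.ext (Subtype.ext ?_) (Subtype.ext ?_)
  · rw [hl, mulAut_pow, h2]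
    ext x
    exact one_mul x.toAdd
  · rw [hr]
    ext x
    obtain ⟨m, rfl⟩ := (Dvd.intro_left t (pow_two t).symm).trans h1
    refine (frobAut_mul_mulAut_pow_apply p n hbq _ x.toAdd).trans ?_
    rw [(hb.pow_eq_one_iff_dvd _).2 h1, pow_pow_mul_of_card hF, Units.val_one, one_mul]
    rfl

include ht hq1 hq hs hF ha hb in
theorem psiG_class_preserving (x : GroupG p n a b) :
    IsConj x (psiG p n (pow_card_eq_self_of_modEq hq hb) x) := by
  have hbq := pow_card_eq_self_of_modEq hq hb
  suffices h : ∃ c : GroupG p n a b, c * x = psiG p n hbq x * c by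
    obtain ⟨c, hc⟩ := h
    exact isConj_iff.2 ⟨c, mul_inv_eq_iff_eq_mul.2 hc⟩
  obtain ⟨d, e⟩ := x
  rw [psiG_mk]
  by_cases he : e = 1
  · subst he
    by_cases hd : d = 1
    · subst hd
      exact ⟨1, by rw [map_one]; simp⟩
    -- Inside `D` the conjugating element comes from `E`.
    · obtain ⟨i, j, hij⟩ :=
        exists_semilinear_eq_mul ht hq1 hq hs hF ha hb (Units.mk0 d.toAdd hd)
      obtain ⟨e', he'⟩ := exists_actE_apply p n (a := a) hbq i j
      have h : actE p n a b e' d = mulAut b d :=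
        (he' d.toAdd).trans (congrArg (fun y : Fˣ => Multiplicative.ofAdd (y : F)) hij)
      exact ⟨⟨1, e'⟩, SemidirectProduct.ext (by simp [h]) (by simp)⟩
  -- Conjugating `(d, e)` by `y` in `D` multiplies `d` by `y / e(y)`. Freeness makes `y ↦ y / e(y)`
  -- injective, hence surjective on the finite group `D`.
  · let f : Multiplicative F →* Multiplicative F :=
      MonoidHom.id _ / (actE p n a b e).toMonoidHom
    have hf : ∀ y, f y = y / actE p n a b e y := fun _ => rfl
    have hinj : Function.Injective f := (injective_iff_map_eq_one f).2 fun y hy => by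
      by_contra hne
      rw [hf, div_eq_one] at hy
      exact he (eq_one_of_actE_apply_eq ht hq1 hq hs hF ha hb e y hne hy.symm)
    obtain ⟨y, hy⟩ := Finite.injective_iff_surjective.1 hinj (mulAut b d / d)
    rw [hf, div_eq_div_iff_mul_eq_mul] at hy
    exact ⟨⟨y, 1⟩, SemidirectProduct.ext (by simp [hy]) (by simp)⟩

include ht hq1 hq hs hF ha hb in
/-- No element of `G` induces multiplication by `b` on `D`. -/
theorem not_exists_conj_mulAut :
    ¬ ∃ x : GroupG p n a b, ∀ d : Multiplicative F,
      (SemidirectProduct.inl d : GroupG p n a b) * x = x * SemidirectProduct.inl (mulAut b d) := by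
  rintro ⟨x, hx⟩
  -- `D` is commutative, so only the `E`-component of `x` matters; it sends `b * d` to `d`, whence
  -- the inverse.
  obtain ⟨i, j, -, -, h⟩ := exists_eq_of_groupE p n (pow_card_eq_self_of_modEq hq hb) x.right⁻¹
  refine not_forall_semilinear_eq_mul ht hq1 hq hs hF ha hb i j fun y => Units.ext ?_
  have h1 : Multiplicative.ofAdd (y : F) = actE p n a b x.right (mulAut b (Multiplicative.ofAdd y)) := by
    have := congrArg SemidirectProduct.left (hx (Multiplicative.ofAdd (y : F)))
    rw [SemidirectProduct.mul_left, SemidirectProduct.mul_left, SemidirectProduct.left_inl,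
      SemidirectProduct.right_inl, SemidirectProduct.left_inl, map_one, MulAut.one_apply,
      mul_comm] at this
    exact mul_left_cancel this
  have h2 := h y
  rw [h1, map_inv, MulAut.inv_apply_self] at h2
  exact h2.symm

end FrobeniusGroup

/-! ### From `Out_c(G)` to `Picent(OG)` -/

section OutCToPicent

variable (O : Type u) (K : Type v) (G : Type w) [CommRing O] [Field K] [CharZero K] [Algebra O K]
  [Group G] [Finite G]

theorem mapRingHom_domCongr {O K G : Type*} [CommRing O] [Field K] [Algebra O K] [Group G]
    (α : MulAut G) (x : MonoidAlgebra O G) :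
    MonoidAlgebra.mapRingHom G (algebraMap O K) (MonoidAlgebra.domCongr O O α x) =
      MonoidAlgebra.domCongr K K α (MonoidAlgebra.mapRingHom G (algebraMap O K) x) := by
  ext g
  simp

theorem twist_fixesSimples (α : AutC G) :
    (ABimodule.twist (MonoidAlgebra.domCongr O O (α : MulAut G))).FixesSimples
      (MonoidAlgebra.mapRingHom G (algebraMap O K)) := by
  intro V _ _ _
  obtain ⟨f, hf⟩ := exists_equiv_of_class_preserving (K := K) (V := V) α.1 α.2
  let _ : Module (MonoidAlgebra O G) V :=
    Module.compHom V (MonoidAlgebra.mapRingHom G (algebraMap O K))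
  refine ABimodule.fixes_twist _ f fun x v => ?_
  change f (MonoidAlgebra.mapRingHom G (algebraMap O K)
    (MonoidAlgebra.domCongr O O (α : MulAut G) x) • v) =
    MonoidAlgebra.mapRingHom G (algebraMap O K) x • f v
  rw [mapRingHom_domCongr, hf]

/-- The homomorphism `α ↦ _α(OG)` from `Aut_c(G)` to the opposite group of `Picent(OG)`. -/
noncomputable def autCToPicent : AutC G →* (Picent O K G)ᵐᵒᵖ where
  toFun α := MulOpposite.op
    ⟨(ABimodule.twistHom O (MonoidAlgebra O G)
      (MonoidAlgebra.domCongrAut (R := O) (A := O) (M := G) α)).unop, _, rfl,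
      twist_fixesSimples O K G α⟩
  map_one' := MulOpposite.unop_injective (Subtype.ext (congrArg MulOpposite.unop
    (map_one ((ABimodule.twistHom O (MonoidAlgebra O G)).comp
      (MonoidAlgebra.domCongrAut (R := O) (A := O) (M := G))))))
  map_mul' α β := MulOpposite.unop_injective (Subtype.ext (congrArg MulOpposite.unop
    (map_mul ((ABimodule.twistHom O (MonoidAlgebra O G)).comp
      (MonoidAlgebra.domCongrAut (R := O) (A := O) (M := G))) α.1 β.1)))

theorem innC_le_ker_autCToPicent : InnC G ≤ (autCToPicent O K G).ker := by
  rintro ⟨α, hα⟩ ⟨g, hg⟩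
  obtain rfl : MulAut.conj g = α := hg
  refine MulOpposite.unop_injective (Subtype.ext (Units.ext (Quotient.sound ?_)))
  refine ABimodule.twist_iso_of_inner _
    -- The inverse is needed: `g⁻¹ * (g * x * g⁻¹) = x * g⁻¹`.
    (Units.map (MonoidAlgebra.of O G) (toUnits g)⁻¹) fun x => ?_
  change MonoidAlgebra.single g⁻¹ (1 : O) * MonoidAlgebra.domCongr O O (MulAut.conj g) x =
    x * MonoidAlgebra.single g⁻¹ (1 : O)
  induction x using MonoidAlgebra.induction_on with
  | of y => simp [MonoidAlgebra.single_mul_single, mul_assoc]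
  | add x y hx hy => rw [map_add, mul_add, hx, hy, add_mul]
  | smul r x hx => rw [map_smul, mul_smul_comm, hx, smul_mul_assoc]

/-- The homomorphism `α ↦ _α(OG)` from the opposite group of `Out_c(G)` to `Picent(OG)`. -/
noncomputable def outCToPicent : (OutC G)ᵐᵒᵖ →* Picent O K G where
  toFun x := (QuotientGroup.lift (InnC G) (autCToPicent O K G)
    (innC_le_ker_autCToPicent O K G) x.unop).unop
  map_one' := by rw [MulOpposite.unop_one, map_one, MulOpposite.unop_one]
  map_mul' x y := by rw [MulOpposite.unop_mul, map_mul, MulOpposite.unop_mul]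

theorem outCToPicent_coe (α : AutC G) :
    (outCToPicent O K G (MulOpposite.op (α : OutC G))).val.val =
      (ABimodule.twist (MonoidAlgebra.domCongr O O (α : MulAut G))).toClass := rfl

end OutCToPicent

/-- `O` is a complete discrete valuation ring with algebraically closed residue field of
characteristic `p` and with fraction field `K` of characteristic zero containing the `|G|`-th roots
of unity; `F` is the field with `p ^ (n t)` elements, where `n` is the order of `p` modulo `t ^ 2`;
`s = (p ^ (n t) - 1) / (t (p ^ n - 1))`; `a` and `b` are primitive roots of unity of orders `s` and
`t ^ 2` in `F`.  The class-preserving automorphisms `α` act on `OG` and give the bimodules `_α(OG)`;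
this defines a homomorphism `Φ` from the opposite group of `Out_c(G)` to `Picent(OG)`. -/
theorem proposition4p2
    {O : Type u} {K : Type v} {F : Type w}
    [CommRing O] [IsDomain O] [IsDiscreteValuationRing O]
    [IsAdicComplete (IsLocalRing.maximalIdeal O) O]
    [IsAlgClosed (IsLocalRing.ResidueField O)]
    [Field K] [CharZero K] [Algebra O K] [IsFractionRing O K]
    (p : ℕ) [Fact p.Prime] [CharP (IsLocalRing.ResidueField O) p]
    (t n s : ℕ) (ht : 1 < t) (htp : t.Coprime p)
    (hn : n = orderOf (p : ZMod (t ^ 2)))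
    (hs : s * (t * (p ^ n - 1)) = p ^ (n * t) - 1)
    [Field F] [Finite F] [CharP F p] (hF : Nat.card F = p ^ (n * t))
    (a b : Fˣ) (ha : IsPrimitiveRoot a s) (hb : IsPrimitiveRoot b (t ^ 2))
    (hK : ∃ ζ : K, IsPrimitiveRoot ζ (Nat.card (GroupG p n a b))) :
    Nontrivial (OutC (GroupG p n a b)) ∧
    ∃ Φ : (OutC (GroupG p n a b))ᵐᵒᵖ →* Picent O K (GroupG p n a b),
      (∀ α : AutC (GroupG p n a b),
        (Φ (MulOpposite.op (α : OutC (GroupG p n a b)))).val.val =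
          (ABimodule.twist (MonoidAlgebra.domCongr O O (α : MulAut (GroupG p n a b)))).toClass) ∧
      Φ.range ≠ ⊥ ∧
      ∃ ψ : AutC (GroupG p n a b),
        (∀ d e, (ψ : MulAut (GroupG p n a b)) ⟨d, e⟩ = ⟨mulAut b d, e⟩) ∧
        (ψ : OutC (GroupG p n a b)) ≠ 1 ∧
        Φ (MulOpposite.op (ψ : OutC (GroupG p n a b))) ≠ 1 := by
  have hp := (Fact.out : p.Prime)
  have hq : p ^ n ≡ 1 [MOD t ^ 2] := by
    rw [← ZMod.natCast_eq_natCast_iff, Nat.cast_pow, hn, pow_orderOf_eq_one, Nat.cast_one]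
  -- The default value `0` of `orderOf` would leave `F` with a single element.
  have hn0 : n ≠ 0 := by
    rintro rfl
    rw [zero_mul, pow_zero] at hF
    have := Finite.one_lt_card (α := F)
    omega
  have hq1 : 1 < p ^ n := Nat.one_lt_pow hn0 hp.one_lt
  have hF' : Nat.card F = (p ^ n) ^ t := by rw [hF, pow_mul]
  have hs' : s * t = ∑ k ∈ Finset.range t, (p ^ n) ^ k := by
    refine Nat.eq_of_mul_eq_mul_right (Nat.sub_pos_of_lt hq1) ?_
    rw [geom_sum_mul_of_one_le hq1.le, mul_assoc, hs, pow_mul]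
  have hbq := pow_card_eq_self_of_modEq hq hb
  let ψ : AutC (GroupG p n a b) :=
    ⟨psiG p n hbq, psiG_class_preserving ht hq1 hq hs' hF' ha hb⟩
  let Φ := outCToPicent O K (GroupG p n a b)
  have hΦ : Φ (MulOpposite.op (ψ : OutC (GroupG p n a b))) ≠ 1 := by
    intro h
    have h1 : (ABimodule.twist (MonoidAlgebra.domCongr O O (psiG p n (a := a) hbq))).toClass =
        (ABimodule.unit O (MonoidAlgebra O (GroupG p n a b))).toClass :=
      congrArg (fun x : Picent O K (GroupG p n a b) => x.val.val) h
    obtain ⟨c, hc⟩ := ABimodule.exists_unit_of_twist_iso _ (Quotient.exact h1)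
    have hP : IsPGroup p (Multiplicative F) := IsPGroup.of_card (n := n * t) hF
    -- Coleman's lemma compares the inclusion of `D` with the inclusion preceded by multiplication
    -- by `b`.
    refine not_exists_conj_mulAut ht hq1 hq hs' hF' ha hb
      (exists_conj_of_unit p hP SemidirectProduct.inl
        (SemidirectProduct.inl.comp (mulAut b).toMonoidHom) c fun d => ?_)
    rw [← hc]
    congr 1
    simp
    rfl
  have hψ : (ψ : OutC (GroupG p n a b)) ≠ 1 := fun h => hΦ (by
    rw [h, MulOpposite.op_one, map_one])
  exact ⟨⟨⟨_, _, hψ⟩⟩, Φ, outCToPicent_coe O K _,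
    fun h => hΦ ((Φ.range.eq_bot_iff_forall.1 h) _ ⟨_, rfl⟩), ψ, fun d e => psiG_mk p n hbq d e,
    hψ, hΦ⟩
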